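/- Let $\mathbb T=\mathbb R\cup\{\infty\}$ be the tropical semiring with $\oplus=\min$ and $\odot=+$, and let $F$ and $G$ be formal tropical (Laurent) polynomials in $d$ variables, that is, finite formal linear combinations of monomials with exponents in $\mathbb Z^d$ and coefficients in $\mathbb T$; let $F\odot G$ be their product. The support $\operatorname{supp}(F)\subset\mathbb Z^d\subset\mathbb R^d$ is the set of exponents $m$ whose coefficient $c_m$ is not $\infty$. For a finite set $A\subset\mathbb R^n$, a *subdivision* of $A$ is a finite polytopal complex (with the empty polytope as a cell) whose vertices lie in $A$ and which covers $\operatorname{conv} A$. For $\lambda\colon A\to\mathbb R$, the *regular subdivision* $\Sigma(A,\lambda)$ consists of the images of the bounded faces of $$U(A,\lambda)=\operatorname{conv}\{(a,\lambda(a)) : a\in A\}+\mathbb R_{\ge 0}\,(0,1)\subset\mathbb R^{n+1}$$ under the projection that omits the last coordinate, and $\Sigma(F):=\Sigma(\operatorname{supp}(F),c)$, where $c$ is the function $m\mapsto c_m$ given by the coefficients of $F$. Let $A,B\subset\mathbb R^d$ be finite. For $A'\subseteq A$ and $B'\subseteq B$ put $M(A',B')=\operatorname{conv}\{a+b : a\in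 A',\ b\in B'\}$, the *mixed cell* with label set $A'\times B'$, and $\operatorname{Cayley}(A',B')=\{(a,-1):a\in A'\}\cup\{(b,1):b\in B'\}\subset\mathbb R^{d+1}$. A subdivision $S$ of $A+B$ is *mixed* if each of its cells can be written as a mixed cell $M(A',B')$, with the labels chosen consistently: the cells labeled $A'\times B'$ and $A''\times B''$ intersect in $M(A'\cap A'',B'\cap B'')$. A mixed subdivision $S$ is *coherent* if there is a regular subdivision $T$ of $\operatorname{Cayley}(A,B)$ such that $$S=\{M(A',B') : A'\subseteq A,\ B'\subseteq B,\ \operatorname{conv}(\operatorname{Cayley}(A',B'))\in T\},$$ and such that a consistent labeling of $S$ can be chosen with $\operatorname{conv}(\operatorname{Cayley}(A',B'))\in T$ for every label set $A'\times B'$ that it uses. **Corollary.** For all formal tropical polynomials $F$ and $G$ in $d$ variables, the regular subdivision $\Sigma(F\odot G)$ is a coherent mixed subdivision of the Minkowski sum $\operatorname{supp}(F)+\operatorname{supp}(G)$. -/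

import Mathlib

open scoped Pointwise

noncomputable section

namespace TropMixed

section Polyhedral

variable {E : Type*} [NormedAddCommGroup E] [NormedSpace ℝ E]

/-- A polytope is the convex hull of finitely many points (the empty polytope is included). -/
def IsPolytope (P : Set E) : Prop :=
  ∃ V : Set E, V.Finite ∧ P = convexHull ℝ V

/-- A finite polytopal complex. The faces of a polytope are its exposed faces; the empty face and
the polytope itself are among them, so the empty polytope is a cell of every complex. -/
structure IsPolytopalComplex (S : Set (Set E)) : Prop where
  finite : S.Finite
  empty_mem : ∅ ∈ S
  isPolytope : ∀ C ∈ S, IsPolytope C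
  face_mem : ∀ C ∈ S, ∀ D : Set E, IsExposed ℝ C D → D ∈ S
  inter_isFace : ∀ C ∈ S, ∀ D ∈ S, IsExposed ℝ C (C ∩ D)

/-- A polyhedral subdivision of the point configuration `A`: a finite polytopal complex whose
vertices lie in `A` and that covers `conv A`. -/
structure IsSubdivision (A : Set E) (S : Set (Set E)) : Prop where
  isComplex : IsPolytopalComplex S
  vertices_subset : ∀ C ∈ S, C.extremePoints ℝ ⊆ A
  covers : ⋃₀ S = convexHull ℝ A

/-- The unbounded polyhedron `U(A, h) = conv {(a, h a) | a ∈ A} + ℝ≥0 (0, 1)`. Only the values of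
`h` on `A` matter. -/
def upperHull (A : Set E) (h : E → ℝ) : Set (E × ℝ) :=
  convexHull ℝ ((fun a : E => (a, h a)) '' A) + {p : E × ℝ | p.1 = 0 ∧ 0 ≤ p.2}

/-- The regular subdivision of `A` by the height function `h`: the projections of the bounded faces
of `U(A, h)`. -/
def regularSubdivision (A : Set E) (h : E → ℝ) : Set (Set E) :=
  {C | ∃ Q : Set (E × ℝ), IsExposed ℝ (upperHull A h) Q ∧ Bornology.IsBounded Q ∧
    C = Prod.fst '' Q}

/-- The cell `M(A', B') = conv {a + b | a ∈ A', b ∈ B'}`. -/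
def mixedCell (A' B' : Set E) : Set E :=
  convexHull ℝ (A' + B')

/-- A consistent labeling of the cells of `S` by mixed cells of `A + B`: each cell `C` is the mixed
cell `M(A', B')` with label set `A' × B'`, where `A' = lA C ⊆ A` and `B' = lB C ⊆ B`, and the cells
labeled `A' × B'` and `A'' × B''` intersect in `M(A' ∩ A'', B' ∩ B'')`. -/
structure IsMixedLabeling (A B : Set E) (S : Set (Set E)) (lA lB : Set E → Set E) : Prop where
  left_subset : ∀ C ∈ S, lA C ⊆ A
  right_subset : ∀ C ∈ S, lB C ⊆ B
  cell_eq : ∀ C ∈ S, C = mixedCell (lA C) (lB C)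
  inter_eq : ∀ C ∈ S, ∀ D ∈ S, C ∩ D = mixedCell (lA C ∩ lA D) (lB C ∩ lB D)

/-- A mixed subdivision of `A + B`: a polyhedral subdivision of `A + B` that is formed from
(consistently labeled) mixed cells. -/
def IsMixedSubdivision (A B : Set E) (S : Set (Set E)) : Prop :=
  IsSubdivision (A + B) S ∧ ∃ lA lB : Set E → Set E, IsMixedLabeling A B S lA lB

/-- The Cayley embedding `{(a, -1) | a ∈ A} ∪ {(b, 1) | b ∈ B}`. -/
def cayley (A B : Set E) : Set (E × ℝ) :=
  (fun a : E => (a, (-1 : ℝ))) '' A ∪ (fun b : E => (b, (1 : ℝ))) '' B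

/-- `M(T) = {M(A', B') | conv (Cayley(A', B')) ∈ T}`, the collection of mixed cells induced by a
subdivision `T` of `Cayley(A, B)`. -/
def inducedMixed (A B : Set E) (T : Set (Set (E × ℝ))) : Set (Set E) :=
  {C | ∃ A' ⊆ A, ∃ B' ⊆ B, convexHull ℝ (cayley A' B') ∈ T ∧ C = mixedCell A' B'}

/-- A mixed subdivision `S` of `A + B` is coherent if it is induced by a regular subdivision of the
Cayley embedding of `A` and `B`; the last condition says that the labels `A' × B'` of the cells of
`S` can be taken from cells `conv (Cayley(A', B'))` of that regular subdivision. -/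
def IsCoherentMixedSubdivision (A B : Set E) (S : Set (Set E)) : Prop :=
  IsMixedSubdivision A B S ∧
  ∃ h : E × ℝ → ℝ, S = inducedMixed A B (regularSubdivision (cayley A B) h) ∧
    ∃ lA lB : Set E → Set E, IsMixedLabeling A B S lA lB ∧
      ∀ C ∈ S, convexHull ℝ (cayley (lA C) (lB C)) ∈ regularSubdivision (cayley A B) h

end Polyhedral

/-- Formal tropical (Laurent) polynomials in `d` variables: finite formal linear combinations of
monomials with exponents in `ℤ^d` and coefficients in the min-plus semiring `ℝ ∪ {∞}`, whose zero
is `∞`. The product of the algebra is the tropical product `F ⊙ G`. -/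
abbrev TropPoly (d : ℕ) : Type :=
  AddMonoidAlgebra (Tropical (WithTop ℝ)) (Fin d → ℤ)

/-- The support `{m | c_m ≠ ∞}` as a point configuration in `ℝ^d`. -/
def supp {d : ℕ} (F : TropPoly d) : Set (Fin d → ℝ) :=
  {x | ∃ m : Fin d → ℤ, F.coeff m ≠ 0 ∧ x = fun i => (m i : ℝ)}

/-- The height function that takes the value `c_m` at each lattice point `m` of the support; its
values at other points are irrelevant. -/
def height {d : ℕ} (F : TropPoly d) (x : Fin d → ℝ) : ℝ :=
  (Tropical.untrop (F.coeff fun i => ⌊x i⌋)).untopD 0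

/-- The regular subdivision `Σ(F)` of the support of `F`, with the coefficients as heights. -/
def tropSubdivision {d : ℕ} (F : TropPoly d) : Set (Set (Fin d → ℝ)) :=
  regularSubdivision (supp F) (height F)

end TropMixed

end

/-!
# Tropical products and coherent mixed subdivisions

For a finite configuration `A` with height function `h`, a bounded nonempty face of `U(A, h)` is
exposed by a functional that decreases in the vertical direction, so after rescaling the nonempty
cells of the regular subdivision are exactly the hulls `conv (minimizers A h φ)`, where
`minimizers A h φ` is the set of points of `A` at which `h - φ` is minimal and `φ` runs through the
linear functionals (`mem_regularSubdivision_iff`). Everything is read off from these sets.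

* Faces of cells are obtained by perturbing `φ` (`exists_minimizers_eq_toExposed`), and the
  intersection of two cells is the hull of the common minimizers
  (`convexHull_minimizers_inter`). That the cells cover `conv A` is linear programming duality,
  deduced from Farkas' lemma (`farkas`, `exists_mem_convexHull_minimizers`).

* The coefficient function of `F ⊙ G` is the infimal convolution of those of `F` and `G`, and there
  is no cancellation, so its support is the Minkowski sum (`isInfConvolution_height`, `supp_mul`).
  Since a minimum over a sum splits into the two minima, the minimizers over `A + B` for `φ` are the
  sums of minimizers over `A` and over `B` for the same `φ`
  (`IsInfConvolution.minimizers_add`), and this is compatible with intersections of minimizers for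
  two functionals (`IsInfConvolution.minimizers_add_inter`). Labeling the cell of `φ` by the two sets
  of minimizers is therefore consistent.

* A functional on the Cayley embedding is a functional `φ` together with a vertical slope. The
  slope only shifts the two levels against each other, so the cells that meet both levels are
  spanned by the minimizers over `A` and over `B` for a common `φ` (`slices_minimizers_cayley`,
  `convexHull_cayley_mem`). A cell determines the hulls of its two slices
  (`convexHull_cayley_inj`), hence its mixed cell, and the induced mixed subdivision is the regular
  subdivision of `A + B` by the infimal convolution.
-/

namespace TropMixed

variable {E : Type*} [NormedAddCommGroup E] [NormedSpace ℝ E]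

/-! ### Exposed faces of convex hulls -/

/-- If `l ≤ M` on `S`, a point of the hull of `S` with `l = M` is already a convex combination of
the points of `S` with `l = M`. -/
theorem mem_convexHull_level {V : Type*} [AddCommGroup V] [Module ℝ V] {S : Set V}
    (l : V →ₗ[ℝ] ℝ) {M : ℝ} (hM : ∀ s ∈ S, l s ≤ M) {x : V} (hx : x ∈ convexHull ℝ S)
    (hxM : M ≤ l x) : x ∈ convexHull ℝ {s ∈ S | l s = M} := by
  have key : convexHull ℝ S ⊆ {x | l x ≤ M ∧ (M ≤ l x → x ∈ convexHull ℝ {s ∈ S | l s = M})} := by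
    refine convexHull_min
      (fun s hs => ⟨hM s hs, fun h => subset_convexHull ℝ _ ⟨hs, (hM s hs).antisymm h⟩⟩) ?_
    rintro y ⟨hy, hy'⟩ z ⟨hz, hz'⟩ a b ha hb hab
    have e : l (a • y + b • z) = a * l y + b * l z := by simp
    have hM' : a * M + b * M = M := by rw [← add_mul, hab, one_mul]
    have h1 := mul_le_mul_of_nonneg_left hy ha
    have h2 := mul_le_mul_of_nonneg_left hz hb
    refine ⟨by rw [e]; linarith, fun h => ?_⟩
    rw [e] at h
    rcases ha.eq_or_lt with rfl | ha0
    · obtain rfl : b = 1 := by linarith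
      simpa using hz' (by linarith)
    rcases hb.eq_or_lt with rfl | hb0
    · obtain rfl : a = 1 := by linarith
      simpa using hy' (by linarith)
    refine convex_convexHull ℝ _ (hy' ?_) (hz' ?_) ha hb hab
    · exact le_of_mul_le_mul_left (by linarith) ha0
    · exact le_of_mul_le_mul_left (by linarith) hb0
  exact (key hx).2 hxM

theorem le_of_mem_convexHull {V : Type*} [AddCommGroup V] [Module ℝ V] {S : Set V}
    (l : V →ₗ[ℝ] ℝ) {M : ℝ} (hM : ∀ s ∈ S, l s ≤ M) {x : V} (hx : x ∈ convexHull ℝ S) :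
    l x ≤ M :=
  convexHull_min (t := {x | l x ≤ M}) hM (convex_halfSpace_le l.isLinear M) hx

/-- The face of a convex hull exposed by `l` is the hull of the generators at which `l` is
largest. -/
theorem toExposed_convexHull (l : StrongDual ℝ E) (S : Set E) :
    l.toExposed (convexHull ℝ S) = convexHull ℝ (l.toExposed S) := by
  ext x
  constructor
  · rintro ⟨hx, hmax⟩
    have hM : ∀ s ∈ S, l.toLinearMap s ≤ l x := fun s hs => hmax s (subset_convexHull ℝ _ hs)
    refine convexHull_mono ?_ (mem_convexHull_level l.toLinearMap hM hx le_rfl)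
    rintro s ⟨hs, hsx⟩
    exact ⟨hs, fun t ht => (hM t ht).trans_eq hsx.symm⟩
  · intro hx
    refine ⟨convexHull_mono (fun s hs => hs.1) hx, fun y hy => ?_⟩
    refine le_of_mem_convexHull l.toLinearMap (fun t ht => ?_) hy
    have := le_of_mem_convexHull (-l.toLinearMap) (S := l.toExposed S) (M := -l t)
      (fun s hs => neg_le_neg (hs.2 t ht)) hx
    exact neg_le_neg_iff.1 this

theorem isExposed_convexHull_iff {S C : Set E} :
    IsExposed ℝ (convexHull ℝ S) C ↔
      C = ∅ ∨ ∃ l : StrongDual ℝ E, C = convexHull ℝ (l.toExposed S) := by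
  constructor
  · intro h
    rcases C.eq_empty_or_nonempty with hC | hC
    · exact Or.inl hC
    · obtain ⟨l, hl⟩ := h hC
      exact Or.inr ⟨l, hl.trans (toExposed_convexHull l S)⟩
  · rintro (rfl | ⟨l, rfl⟩)
    · exact isExposed_empty
    · rw [← toExposed_convexHull]
      exact ContinuousLinearMap.toExposed.isExposed

/-! ### The cells of a regular subdivision -/

/-- The points of `A` at which the tilted height function `h - φ` attains its minimum over `A`. -/
def minimizers (A : Set E) (h : E → ℝ) (φ : StrongDual ℝ E) : Set E :=
  {a ∈ A | ∀ b ∈ A, h a - φ a ≤ h b - φ b}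

theorem minimizers_subset (A : Set E) (h : E → ℝ) (φ : StrongDual ℝ E) :
    minimizers A h φ ⊆ A := fun _ ha => ha.1

theorem minimizers_nonempty {A : Set E} (hA : A.Finite) (hne : A.Nonempty) (h : E → ℝ)
    (φ : StrongDual ℝ E) : (minimizers A h φ).Nonempty := by
  obtain ⟨a, ha, hmin⟩ := Set.exists_min_image A (fun a => h a - φ a) hA hne
  exact ⟨a, ha, hmin⟩

/-- The graph of the height function over the configuration. -/
def liftedPoints {X : Type*} (A : Set X) (h : X → ℝ) : Set (X × ℝ) := (fun a => (a, h a)) '' A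

theorem fst_image_liftedPoints {X : Type*} (A : Set X) (h : X → ℝ) :
    Prod.fst '' liftedPoints A h = A := by
  simp [liftedPoints, Set.image_image]

theorem fst_image_convexHull (S : Set (E × ℝ)) :
    Prod.fst '' convexHull ℝ S = convexHull ℝ (Prod.fst '' S) :=
  (LinearMap.fst ℝ E ℝ).image_convexHull S

theorem apply_mk {V L : Type*} [AddCommGroup V] [Module ℝ V] [FunLike L (V × ℝ) ℝ]
    [LinearMapClass L ℝ (V × ℝ) ℝ] (l : L) (x : V) (r : ℝ) :
    l (x, r) = l (x, 0) + r * l (0, 1) := by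
  have : ((x, r) : V × ℝ) = (x, 0) + r • (0, 1) := by simp
  rw [this, map_add, map_smul, smul_eq_mul]

/-- The bounded nonempty faces of `U(A, h)` are cut out by functionals that decrease in the vertical
direction, and such a functional exposes the same face of `U(A, h)` as of the hull of the lifted
points. -/
theorem toExposed_upperHull {A : Set E} {h : E → ℝ} (l : StrongDual ℝ (E × ℝ))
    (hl : l (0, 1) < 0) :
    l.toExposed (upperHull A h) = convexHull ℝ (l.toExposed (liftedPoints A h)) := by
  rw [← toExposed_convexHull]
  have hsub : convexHull ℝ (liftedPoints A h) ⊆ upperHull A h := fun p hp =>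
    ⟨p, hp, 0, by simp, by simp⟩
  ext p
  constructor
  · rintro ⟨⟨q, hq, ⟨z, r⟩, ⟨hz, hr⟩, rfl⟩, hmax⟩
    obtain rfl : z = 0 := hz
    have hr : 0 ≤ r := hr
    have h1 := hmax q (hsub hq)
    simp only [map_add] at h1
    rw [apply_mk l 0 r, Prod.mk_zero_zero, map_zero] at h1
    obtain rfl : r = 0 := by nlinarith
    simp only [Prod.mk_zero_zero, add_zero] at hmax ⊢
    exact ⟨hq, fun y hy => hmax y (hsub hy)⟩
  · rintro ⟨hp, hmax⟩
    refine ⟨hsub hp, ?_⟩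
    rintro _ ⟨q, hq, ⟨z, r⟩, ⟨hz, hr⟩, rfl⟩
    obtain rfl : z = 0 := hz
    have hr : 0 ≤ r := hr
    simp only [map_add]
    rw [apply_mk l 0 r, Prod.mk_zero_zero, map_zero]
    have := hmax q hq
    nlinarith

/-- A functional that vanishes on the vertical direction exposes a union of vertical rays, and one
that is positive on it is unbounded above on `U(A, h)`. -/
theorem apply_vertical_neg_of_isBounded {A : Set E} {h : E → ℝ} (l : StrongDual ℝ (E × ℝ))
    (hne : (l.toExposed (upperHull A h)).Nonempty)
    (hb : Bornology.IsBounded (l.toExposed (upperHull A h))) : l (0, 1) < 0 := by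
  obtain ⟨p, ⟨q, hq, z, ⟨hz, hz'⟩, rfl⟩, hmax⟩ := hne
  have hmem : ∀ r : ℝ, 0 ≤ r → q + z + (0, r) ∈ upperHull A h := fun r hr =>
    ⟨q, hq, z + (0, r), ⟨by simpa using hz, by simpa using add_nonneg hz' hr⟩, by
      simp [add_assoc]⟩
  have hval : ∀ r : ℝ, l (q + z + (0, r)) = l (q + z) + r * l (0, 1) := fun r => by
    rw [map_add l (q + z), apply_mk l 0 r, Prod.mk_zero_zero, map_zero, zero_add]
  have h1 := hmax _ (hmem 1 zero_le_one)
  rw [hval] at h1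
  refine lt_of_le_of_ne (by linarith) fun h0 => ?_
  obtain ⟨R, hR⟩ := hb.exists_norm_le
  have hR' : ∀ r : ℝ, 0 ≤ r → ‖q + z + (0, r)‖ ≤ R := fun r hr => hR _
    ⟨hmem r hr, fun y hy => by rw [hval, h0]; simpa using hmax y hy⟩
  have hR0 : 0 ≤ R := (norm_nonneg _).trans (hR' 0 le_rfl)
  have h2 := hR' (R + 1 - (q + z).2 + |(q + z).2|)
    (by have := le_abs_self (q + z).2; linarith)
  have h3 := (norm_snd_le _).trans h2
  have h4 := (le_abs_self _).trans h3
  simp only [Prod.snd_add] at h4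
  have := abs_nonneg (q + z).2
  simp only [Prod.snd_add] at this
  linarith

theorem fst_image_toExposed_liftedPoints {A : Set E} {h : E → ℝ} {l : StrongDual ℝ (E × ℝ)}
    {φ : StrongDual ℝ E} {c : ℝ} (hc : 0 < c) (hl : ∀ x r, l (x, r) = c * (φ x - r)) :
    Prod.fst '' l.toExposed (liftedPoints A h) = minimizers A h φ := by
  ext a
  constructor
  · rintro ⟨_, ⟨⟨a, ha, rfl⟩, hmax⟩, rfl⟩
    refine ⟨ha, fun b hb => ?_⟩
    have := hmax _ ⟨b, hb, rfl⟩
    rw [hl, hl] at this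
    linarith [le_of_mul_le_mul_left this hc]
  · rintro ⟨ha, hmin⟩
    refine ⟨(a, h a), ⟨⟨a, ha, rfl⟩, ?_⟩, rfl⟩
    rintro _ ⟨b, hb, rfl⟩
    rw [hl, hl]
    exact mul_le_mul_of_nonneg_left (by linarith [hmin b hb]) hc.le

/-- The nonempty cells of the regular subdivision are the hulls of the sets of minimizers of the
tilted height functions. The alternative `C = ∅` is needed for nonempty `A`, where the minimum is
always attained. -/
theorem mem_regularSubdivision_iff {A : Set E} (hA : A.Finite) {h : E → ℝ} {C : Set E} :
    C ∈ regularSubdivision A h ↔ C = ∅ ∨ ∃ φ, C = convexHull ℝ (minimizers A h φ) := by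
  constructor
  · rintro ⟨Q, hQ, hb, rfl⟩
    rcases Q.eq_empty_or_nonempty with rfl | hne
    · simp
    obtain ⟨l, hl⟩ := hQ hne
    obtain rfl : Q = l.toExposed (upperHull A h) := hl
    have hneg := apply_vertical_neg_of_isBounded l hne hb
    refine Or.inr ⟨(-l (0, 1))⁻¹ • l.comp (ContinuousLinearMap.inl ℝ E ℝ), ?_⟩
    rw [toExposed_upperHull l hneg, fst_image_convexHull,
      fst_image_toExposed_liftedPoints (neg_pos.2 hneg)]
    intro x r
    rw [apply_mk l x r]
    have := hneg.ne
    simp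
    field_simp
    ring
  · rintro (rfl | ⟨φ, rfl⟩)
    · exact ⟨∅, isExposed_empty, Bornology.isBounded_empty, by simp⟩
    · let l : StrongDual ℝ (E × ℝ) :=
        φ.comp (ContinuousLinearMap.fst ℝ E ℝ) - ContinuousLinearMap.snd ℝ E ℝ
      have hl : ∀ x r, l (x, r) = 1 * (φ x - r) := fun x r => by simp [l]
      have e := toExposed_upperHull (A := A) (h := h) l (by simp [l])
      refine ⟨l.toExposed (upperHull A h), ContinuousLinearMap.toExposed.isExposed, ?_, ?_⟩
      · rw [e, isBounded_convexHull]
        exact ((hA.image _).subset fun s hs => hs.1).isBounded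
      · rw [e, fst_image_convexHull, fst_image_toExposed_liftedPoints one_pos hl]

/-- Two cells of a regular subdivision meet in the hull of their common minimizers: on the first
configuration of minimizers `ψ - φ` is at most the difference of the two minimal values, on the
second it is at least that difference, and equality on the first means membership in the second. -/
theorem convexHull_minimizers_inter (A : Set E) (h : E → ℝ) (φ ψ : StrongDual ℝ E) :
    convexHull ℝ (minimizers A h φ) ∩ convexHull ℝ (minimizers A h ψ) =
      convexHull ℝ (minimizers A h φ ∩ minimizers A h ψ) := by
  apply Set.Subset.antisymm
  · rintro x ⟨hx, hx'⟩
    obtain ⟨a, ha⟩ := convexHull_nonempty_iff.1 ⟨x, hx⟩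
    obtain ⟨c, hc⟩ := convexHull_nonempty_iff.1 ⟨x, hx'⟩
    have h1 : ∀ s ∈ minimizers A h φ, (ψ - φ).toLinearMap s ≤ (h a - φ a) - (h c - ψ c) := by
      intro s hs
      have := hs.2 a ha.1
      have := hc.2 s hs.1
      simp
      linarith
    have h2 : ∀ s ∈ minimizers A h ψ, (φ - ψ).toLinearMap s ≤ (h c - ψ c) - (h a - φ a) := by
      intro s hs
      have := hs.2 c hc.1
      have := ha.2 s hs.1
      simp
      linarith
    have h3 := le_of_mem_convexHull _ h2 hx'
    refine convexHull_mono ?_ (mem_convexHull_level _ h1 hx (by simp at h3 ⊢; linarith))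
    rintro s ⟨hs, hsM⟩
    refine ⟨hs, hs.1, fun b hb => ?_⟩
    have := hc.2 b hb
    have := hs.2 a ha.1
    simp at hsM
    linarith
  · exact Set.subset_inter (convexHull_mono Set.inter_subset_left)
      (convexHull_mono Set.inter_subset_right)

theorem isExposed_inter_minimizers (A : Set E) (h : E → ℝ) (φ ψ : StrongDual ℝ E) :
    IsExposed ℝ (convexHull ℝ (minimizers A h φ))
      (convexHull ℝ (minimizers A h φ) ∩ convexHull ℝ (minimizers A h ψ)) := by
  rw [convexHull_minimizers_inter, isExposed_convexHull_iff]
  rcases (minimizers A h φ ∩ minimizers A h ψ).eq_empty_or_nonempty with he | ⟨e, he, he'⟩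
  · exact Or.inl (by simp [he])
  refine Or.inr ⟨ψ - φ, congrArg _ ?_⟩
  ext a
  constructor
  · rintro ⟨ha, ha'⟩
    refine ⟨ha, fun b hb => ?_⟩
    have := ha'.2 e he.1
    have := ha.2 b hb.1
    have := hb.2 a ha.1
    have := he'.2 b hb.1
    simp
    linarith [he.2 a ha.1]
  · rintro ⟨ha, hmax⟩
    refine ⟨ha, ha.1, fun b hb => ?_⟩
    have := hmax e he
    simp at this
    linarith [he'.2 b hb, ha.2 e he.1]

/-- A face of a cell is a cell: perturbing `φ` by a small positive multiple of `l` selects those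
minimizers of `h - φ` at which `l` is largest. -/
theorem exists_minimizers_eq_toExposed {A : Set E} (hA : A.Finite) (h : E → ℝ)
    (φ l : StrongDual ℝ E) (hne : (l.toExposed (minimizers A h φ)).Nonempty) :
    ∃ ψ, minimizers A h ψ = l.toExposed (minimizers A h φ) := by
  obtain ⟨e, he, hemax⟩ := hne
  have hev : ∀ a ∈ A, ∀ᶠ ε : ℝ in nhdsWithin 0 (Set.Ioi 0),
      a ∉ minimizers A h φ → ε * (l a - l e) < (h a - φ a) - (h e - φ e) := by
    intro a ha
    by_cases hmem : a ∈ minimizers A h φ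
    · exact Filter.Eventually.of_forall fun ε hε => absurd hmem hε
    have hgap : 0 * (l a - l e) < (h a - φ a) - (h e - φ e) := by
      rw [zero_mul, sub_pos]
      by_contra hle
      exact hmem ⟨ha, fun b hb => (not_lt.1 hle).trans (he.2 b hb)⟩
    have hcont : Filter.Tendsto (fun ε : ℝ => ε * (l a - l e)) (nhdsWithin 0 (Set.Ioi 0))
        (nhds (0 * (l a - l e))) :=
      ((continuous_id.mul continuous_const).tendsto 0).mono_left nhdsWithin_le_nhds
    exact (hcont.eventually_lt_const hgap).mono fun ε hε _ => hε
  obtain ⟨ε, hε, hpos⟩ :=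
    (((Filter.eventually_all_finite hA).2 hev).and self_mem_nhdsWithin).exists
  have hpos : 0 < ε := hpos
  refine ⟨φ + ε • l, ?_⟩
  ext a
  constructor
  · rintro ⟨ha, hmin⟩
    have h1 := hmin e he.1
    simp at h1
    have hmem : a ∈ minimizers A h φ := by
      by_contra hmem
      have := hε a ha hmem
      linarith
    refine ⟨hmem, fun b hb => (hemax b hb).trans ?_⟩
    have := he.2 a ha
    have := hmem.2 e he.1
    exact le_of_mul_le_mul_left (by linarith) hpos
  · rintro ⟨ha, hmax⟩
    refine ⟨ha.1, fun b hb => ?_⟩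
    have h1 := mul_le_mul_of_nonneg_left (hmax e he) hpos.le
    simp
    by_cases hmem : b ∈ minimizers A h φ
    · have := mul_le_mul_of_nonneg_left (hmax b hmem) hpos.le
      linarith [ha.2 b hb]
    · have := hε b hb hmem
      linarith [ha.2 e he.1]

/-! ### Farkas' lemma and the covering property -/

/-- Farkas' lemma: a vector outside the cone generated by finitely many vectors is separated from
it by a linear functional. The induction on the generators follows Bartl: if the functional `l`
found for the old generators is negative on the new one `w`, everything is projected along `w` to
the kernel of `l`. -/
theorem farkas {V ι : Type*} [AddCommGroup V] [Module ℝ V] (s : Finset ι) :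
    ∀ (v : ι → V) (x : V), (∃ c : ι → ℝ, (∀ i ∈ s, 0 ≤ c i) ∧ ∑ i ∈ s, c i • v i = x) ∨
      ∃ l : V →ₗ[ℝ] ℝ, (∀ i ∈ s, 0 ≤ l (v i)) ∧ l x < 0 := by
  classical
  induction s using Finset.induction_on with
  | empty =>
    intro v x
    by_cases hx : x = 0
    · exact Or.inl ⟨0, by simp, by simp [hx]⟩
    · obtain ⟨f, hf⟩ := not_forall.1 ((Module.forall_dual_apply_eq_zero_iff ℝ x).not.2 hx)
      rcases lt_or_gt_of_ne hf with h | h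
      · exact Or.inr ⟨f, by simp, h⟩
      · exact Or.inr ⟨-f, by simp, by simpa using h⟩
  | insert j s hj ih =>
    intro v x
    rcases ih v x with ⟨c, hc, hcx⟩ | ⟨l, hl, hlx⟩
    · left
      refine ⟨Function.update c j 0, fun i hi => ?_, ?_⟩
      · rcases eq_or_ne i j with rfl | hij
        · simp
        · rw [Function.update_of_ne hij]
          exact hc i ((Finset.mem_insert.1 hi).resolve_left hij)
      · rw [Finset.sum_insert hj, Function.update_self, zero_smul, zero_add, ← hcx]
        refine Finset.sum_congr rfl fun i hi => ?_
        rw [Function.update_of_ne (ne_of_mem_of_not_mem hi hj)]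
    by_cases hw : 0 ≤ l (v j)
    · exact Or.inr ⟨l, by simpa [hw] using hl, hlx⟩
    push Not at hw
    -- The new generator is rescaled by `k` to make its value under `l` equal to `-1`.
    set k : ℝ := (-l (v j))⁻¹ with hk
    have hk0 : 0 < k := inv_pos.2 (neg_pos.2 hw)
    have hlw : l (k • v j) = -1 := by
      rw [map_smul, smul_eq_mul, hk]
      have := hw.ne
      field_simp
    rcases ih (fun i => v i + l (v i) • k • v j) (x + l x • k • v j) with
      ⟨c, hc, hcx⟩ | ⟨l', hl', hlx'⟩
    · left
      have hsum : 0 ≤ ∑ i ∈ s, c i * l (v i) :=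
        Finset.sum_nonneg fun i hi => mul_nonneg (hc i hi) (hl i hi)
      refine ⟨Function.update c j ((∑ i ∈ s, c i * l (v i) - l x) * k), fun i hi => ?_, ?_⟩
      · rcases eq_or_ne i j with rfl | hij
        · rw [Function.update_self]
          exact mul_nonneg (by linarith) hk0.le
        · rw [Function.update_of_ne hij]
          exact hc i ((Finset.mem_insert.1 hi).resolve_left hij)
      · rw [Finset.sum_insert hj, Function.update_self]
        have e : ∑ i ∈ s, Function.update c j ((∑ i ∈ s, c i * l (v i) - l x) * k) i • v i =
            ∑ i ∈ s, c i • v i := Finset.sum_congr rfl fun i hi => by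
          rw [Function.update_of_ne (ne_of_mem_of_not_mem hi hj)]
        rw [e]
        simp only [smul_add, smul_smul, Finset.sum_add_distrib, ← Finset.sum_smul,
          ← mul_assoc, ← Finset.sum_mul] at hcx
        rw [sub_mul, sub_smul, ← add_sub_right_comm, add_comm, hcx, add_sub_cancel_right]
    · right
      refine ⟨l' ∘ₗ (LinearMap.id + l.smulRight (k • v j)), fun i hi => ?_, by simpa using hlx'⟩
      rcases Finset.mem_insert.1 hi with rfl | hi
      · have : v i + l (v i) • k • v i = 0 := by
          rw [smul_smul, hk]
          have := hw.ne
          have e : l (v i) * (-l (v i))⁻¹ = -1 := by field_simp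
          rw [e]
          simp
        simp [-map_add, this]
      · simpa using hl' i hi

/-- The cells of the regular subdivision cover `conv A`. Let `(y, t)` be the lowest point above `y`
of the hull of the lifted points. The cone of directions from `(y, t)` to the lifted points does not
contain `(0, -1)`, so Farkas' lemma yields a functional that is nonnegative on this cone and positive
on `(0, 1)`; unlike a supporting hyperplane at a boundary point, it cannot be vertical. -/
theorem exists_mem_convexHull_minimizers [FiniteDimensional ℝ E] {A : Set E} (hA : A.Finite)
    (h : E → ℝ) {y : E} (hy : y ∈ convexHull ℝ A) :
    ∃ φ : StrongDual ℝ E, y ∈ convexHull ℝ (minimizers A h φ) := by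
  -- `(y, t)` is the lowest point above `y` of the hull of the lifted points.
  obtain ⟨t, ht, htmin⟩ : ∃ t, (y, t) ∈ convexHull ℝ (liftedPoints A h) ∧
      ∀ r, (y, r) ∈ convexHull ℝ (liftedPoints A h) → t ≤ r := by
    have hcomp : IsCompact (convexHull ℝ (liftedPoints A h) ∩ Prod.fst ⁻¹' {y}) :=
      ((hA.image _).isCompact_convexHull ℝ).inter_right (isClosed_singleton.preimage continuous_fst)
    rw [← fst_image_liftedPoints A h, ← fst_image_convexHull] at hy
    obtain ⟨p, hp, rfl⟩ := hy
    obtain ⟨⟨z, t⟩, ⟨hq, hz⟩, hmin⟩ :=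
      hcomp.exists_isMinOn ⟨p, hp, rfl⟩ continuous_snd.continuousOn
    obtain rfl : z = p.1 := hz
    exact ⟨t, hq, fun r hr => hmin ⟨hr, rfl⟩⟩
  rcases farkas hA.toFinset (fun a => ((a - y, h a - t) : E × ℝ)) (0, -1) with
    ⟨c, hc, hsum⟩ | ⟨l, hl, hlneg⟩
  · exfalso
    obtain ⟨h1, h2⟩ := Prod.ext_iff.1 hsum
    simp only [Prod.fst_sum, Prod.snd_sum, Prod.smul_fst, Prod.smul_snd, smul_eq_mul] at h1 h2
    have hC0 : 0 ≤ ∑ a ∈ hA.toFinset, c a := Finset.sum_nonneg hc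
    -- Rescaled to total weight `1`, the conic combination would give a point of the hull at
    -- height `t - K⁻¹` above `y`.
    rcases hC0.eq_or_lt with hC | hC
    · have hzero := (Finset.sum_eq_zero_iff_of_nonneg hc).1 hC.symm
      rw [Finset.sum_eq_zero fun a ha => by rw [hzero a ha, zero_mul]] at h2
      norm_num at h2
    set K := ∑ a ∈ hA.toFinset, c a with hK
    have hmem := Finset.centerMass_mem_convexHull (R := ℝ) (s := liftedPoints A h) hA.toFinset
      (w := c) hc hC (z := fun a => (a, h a))
      (fun a ha => ⟨a, hA.mem_toFinset.1 ha, rfl⟩)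
    have e : hA.toFinset.centerMass c (fun a => (a, h a)) = (y, t - K⁻¹) := by
      rw [Finset.centerMass, ← hK, inv_smul_eq_iff₀ hC.ne']
      simp only [smul_sub, mul_sub, Finset.sum_sub_distrib, ← Finset.sum_smul, ← Finset.sum_mul,
        ← hK] at h1 h2
      ext1
      · simpa [Prod.fst_sum] using sub_eq_zero.1 h1
      · simp [Prod.snd_sum, mul_sub, mul_inv_cancel₀ hC.ne']
        linarith
    rw [e] at hmem
    have := htmin _ hmem
    have := inv_pos.2 hC
    linarith
  · set k := l (0, 1) with hk
    have hsplit : ∀ x r, l (x, r) = l (x, 0) + r * k := apply_mk l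
    have hk0 : 0 < k := by
      have := hsplit 0 (-1)
      rw [Prod.mk_zero_zero, map_zero] at this
      linarith
    let φ : StrongDual ℝ E := LinearMap.toContinuousLinearMap (-k⁻¹ • l ∘ₗ LinearMap.inl ℝ E ℝ)
    have hφ : ∀ x, φ x = -k⁻¹ * l (x, 0) := fun x => by simp [φ]
    let L : E × ℝ →ₗ[ℝ] ℝ := φ.toLinearMap ∘ₗ LinearMap.fst ℝ E ℝ - LinearMap.snd ℝ E ℝ
    have hL : ∀ x r, L (x, r) = φ x - r := fun x r => by simp [L]
    have hle : ∀ a ∈ A, φ a - h a ≤ φ y - t := fun a ha => by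
      have h1 := hl a (hA.mem_toFinset.2 ha)
      have h2 : l (a - y, 0) = l (a, 0) - l (y, 0) := by rw [← map_sub]; simp
      rw [hsplit, h2] at h1
      have h3 := mul_nonneg (inv_pos.2 hk0).le h1
      have h4 : k⁻¹ * (l (a, 0) - l (y, 0) + (h a - t) * k) =
          k⁻¹ * l (a, 0) - k⁻¹ * l (y, 0) + (h a - t) := by field_simp
      rw [hφ, hφ]
      linarith
    refine ⟨φ, ?_⟩
    have hface := mem_convexHull_level L (M := φ y - t) (S := liftedPoints A h)
      (by rintro _ ⟨a, ha, rfl⟩; rw [hL]; exact hle a ha) ht (hL y t).ge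
    have himg := Set.mem_image_of_mem Prod.fst hface
    rw [fst_image_convexHull] at himg
    refine convexHull_mono ?_ himg
    rintro _ ⟨_, ⟨⟨a, ha, rfl⟩, haM⟩, rfl⟩
    rw [hL] at haM
    exact ⟨ha, fun b hb => by linarith [hle b hb]⟩

/-- Every regular subdivision is a subdivision. -/
theorem isSubdivision_regularSubdivision [FiniteDimensional ℝ E] {A : Set E} (hA : A.Finite)
    (h : E → ℝ) : IsSubdivision A (regularSubdivision A h) where
  isComplex :=
    { finite := by
        refine (((hA.finite_subsets).image (convexHull ℝ)).insert ∅).subset fun C hC => ?_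
        rcases (mem_regularSubdivision_iff hA).1 hC with rfl | ⟨φ, rfl⟩
        · exact Set.mem_insert _ _
        · exact Set.mem_insert_of_mem _ ⟨_, minimizers_subset A h φ, rfl⟩
      empty_mem := (mem_regularSubdivision_iff hA).2 (Or.inl rfl)
      isPolytope := fun C hC => by
        rcases (mem_regularSubdivision_iff hA).1 hC with rfl | ⟨φ, rfl⟩
        · exact ⟨∅, Set.finite_empty, by simp⟩
        · exact ⟨_, hA.subset (minimizers_subset A h φ), rfl⟩
      face_mem := fun C hC D hD => by
        rw [mem_regularSubdivision_iff hA] at hC ⊢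
        rcases D.eq_empty_or_nonempty with hDe | hDne
        · exact Or.inl hDe
        rcases hC with rfl | ⟨φ, rfl⟩
        · exact Or.inl (Set.subset_empty_iff.1 hD.subset)
        rcases isExposed_convexHull_iff.1 hD with rfl | ⟨l, rfl⟩
        · exact Or.inl rfl
        obtain ⟨ψ, hψ⟩ := exists_minimizers_eq_toExposed hA h φ l (convexHull_nonempty_iff.1 hDne)
        exact Or.inr ⟨ψ, by rw [hψ]⟩
      inter_isFace := fun C hC D hD => by
        rcases (mem_regularSubdivision_iff hA).1 hC with rfl | ⟨φ, rfl⟩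
        · rw [Set.empty_inter]
        rcases (mem_regularSubdivision_iff hA).1 hD with rfl | ⟨ψ, rfl⟩
        · rw [Set.inter_empty]; exact isExposed_empty
        exact isExposed_inter_minimizers A h φ ψ }
  vertices_subset := fun C hC => by
    rcases (mem_regularSubdivision_iff hA).1 hC with rfl | ⟨φ, rfl⟩
    · simp
    · exact extremePoints_convexHull_subset.trans (minimizers_subset A h φ)
  covers := by
    apply Set.Subset.antisymm
    · refine Set.sUnion_subset fun C hC => ?_
      rcases (mem_regularSubdivision_iff hA).1 hC with rfl | ⟨φ, rfl⟩
      · exact Set.empty_subset _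
      · exact convexHull_mono (minimizers_subset A h φ)
    · intro y hy
      obtain ⟨φ, hφ⟩ := exists_mem_convexHull_minimizers hA h hy
      exact ⟨_, (mem_regularSubdivision_iff hA).2 (Or.inr ⟨φ, rfl⟩), hφ⟩

/-! ### Infimal convolution of height functions -/

/-- On `A + B`, the height function `h` is the infimal convolution of `f` on `A` and `g` on `B`:
`h x` is the least value of `f a + g b` over the decompositions `x = a + b`, and it is attained. -/
structure IsInfConvolution (A B : Set E) (f g h : E → ℝ) : Prop where
  le : ∀ a ∈ A, ∀ b ∈ B, h (a + b) ≤ f a + g b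
  exists_eq : ∀ x ∈ A + B, ∃ a ∈ A, ∃ b ∈ B, a + b = x ∧ h x = f a + g b

namespace IsInfConvolution

variable {A B : Set E} {f g h : E → ℝ}

/-- In an optimal decomposition of a minimizer, both summands are minimizers. -/
theorem mem_minimizers (H : IsInfConvolution A B f g h) {φ : StrongDual ℝ E} {a b : E}
    (ha : a ∈ A) (hb : b ∈ B) (hab : h (a + b) = f a + g b)
    (hmem : a + b ∈ minimizers (A + B) h φ) : a ∈ minimizers A f φ ∧ b ∈ minimizers B g φ := by
  refine ⟨⟨ha, fun c hc => ?_⟩, ⟨hb, fun c hc => ?_⟩⟩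
  · have h1 := hmem.2 _ (Set.add_mem_add hc hb)
    rw [map_add, map_add] at h1
    linarith [H.le c hc b hb]
  · have h1 := hmem.2 _ (Set.add_mem_add ha hc)
    rw [map_add, map_add] at h1
    linarith [H.le a ha c hc]

theorem minimizers_add (H : IsInfConvolution A B f g h) (φ : StrongDual ℝ E) :
    minimizers (A + B) h φ = minimizers A f φ + minimizers B g φ := by
  ext x
  constructor
  · intro hx
    obtain ⟨a, ha, b, hb, rfl, hab⟩ := H.exists_eq x hx.1
    obtain ⟨ha', hb'⟩ := H.mem_minimizers ha hb hab hx
    exact Set.add_mem_add ha' hb'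
  · rintro ⟨a, ha, b, hb, rfl⟩
    refine ⟨Set.add_mem_add ha.1 hb.1, fun y hy => ?_⟩
    obtain ⟨c, hc, e, he, rfl, hce⟩ := H.exists_eq y hy
    simp only [map_add]
    linarith [H.le a ha.1 b hb.1, ha.2 c hc, hb.2 e he]

theorem minimizers_add_inter (H : IsInfConvolution A B f g h) (φ ψ : StrongDual ℝ E) :
    minimizers (A + B) h φ ∩ minimizers (A + B) h ψ =
      (minimizers A f φ ∩ minimizers A f ψ) + (minimizers B g φ ∩ minimizers B g ψ) := by
  ext x
  constructor
  · rintro ⟨hx, hx'⟩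
    obtain ⟨a, ha, b, hb, rfl, hab⟩ := H.exists_eq x hx.1
    obtain ⟨ha₁, hb₁⟩ := H.mem_minimizers ha hb hab hx
    obtain ⟨ha₂, hb₂⟩ := H.mem_minimizers ha hb hab hx'
    exact Set.add_mem_add ⟨ha₁, ha₂⟩ ⟨hb₁, hb₂⟩
  · rintro ⟨a, ha, b, hb, rfl⟩
    rw [H.minimizers_add, H.minimizers_add]
    exact ⟨Set.add_mem_add ha.1 hb.1, Set.add_mem_add ha.2 hb.2⟩

end IsInfConvolution

/-! ### The Cayley embedding -/

/-- The height function on the Cayley embedding that is `f` on the level `-1` and `g` on the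
level `1`. -/
noncomputable def cayleyHeight {X : Type*} (f g : X → ℝ) (p : X × ℝ) : ℝ :=
  if p.2 < 0 then f p.1 else g p.1

theorem cayleyHeight_left {X : Type*} (f g : X → ℝ) (a : X) : cayleyHeight f g (a, -1) = f a := by
  simp [cayleyHeight]

theorem cayleyHeight_right {X : Type*} (f g : X → ℝ) (b : X) : cayleyHeight f g (b, 1) = g b := by
  simp [cayleyHeight, not_lt.2 zero_le_one]

theorem left_mem_cayley {X : Type*} {A B : Set X} {a : X} : (a, (-1 : ℝ)) ∈ cayley A B ↔ a ∈ A := by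
  have : ¬ (1 : ℝ) = -1 := by norm_num
  simp [cayley, this]

theorem right_mem_cayley {X : Type*} {A B : Set X} {b : X} : (b, (1 : ℝ)) ∈ cayley A B ↔ b ∈ B := by
  have : ¬ (-1 : ℝ) = 1 := by norm_num
  simp [cayley, this]

theorem cayley_ext {X : Type*} {A B : Set X} {S : Set (X × ℝ)} (hS : S ⊆ cayley A B) :
    S = cayley {a | (a, (-1 : ℝ)) ∈ S} {b | (b, (1 : ℝ)) ∈ S} := by
  ext p
  constructor
  · intro hp
    rcases hS hp with ⟨a, -, rfl⟩ | ⟨b, -, rfl⟩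
    · exact left_mem_cayley.2 hp
    · exact right_mem_cayley.2 hp
  · rintro (⟨a, ha, rfl⟩ | ⟨b, hb, rfl⟩)
    · exact ha
    · exact hb

theorem finite_cayley {X : Type*} {A B : Set X} (hA : A.Finite) (hB : B.Finite) : (cayley A B).Finite :=
  (hA.image _).union (hB.image _)

/-- If `S` lies on one side of the horizontal hyperplane at height `ε = ±1`, the slice of its hull
at that height is the hull of its slice. -/
theorem mem_convexHull_slice {S : Set (E × ℝ)} {ε : ℝ} (hε : ε * ε = 1)
    (hS : ∀ p ∈ S, ε * p.2 ≤ 1) {x : E} :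
    (x, ε) ∈ convexHull ℝ S ↔ x ∈ convexHull ℝ {x | (x, ε) ∈ S} := by
  constructor
  · intro hx
    have h1 := mem_convexHull_level (ε • LinearMap.snd ℝ E ℝ) (M := 1) (by simpa using hS) hx
      (by simp [hε])
    have h2 := Set.mem_image_of_mem Prod.fst h1
    rw [fst_image_convexHull] at h2
    refine convexHull_mono ?_ h2
    rintro _ ⟨⟨y, r⟩, ⟨hp, hr⟩, rfl⟩
    simp only [LinearMap.smul_apply, LinearMap.snd_apply, smul_eq_mul] at hr
    obtain rfl : r = ε := by rw [← one_mul r, ← hε, mul_assoc, hr, mul_one]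
    exact hp
  · refine fun hx => convexHull_min (t := {x | (x, ε) ∈ convexHull ℝ S})
      (fun y hy => subset_convexHull ℝ _ hy) ?_ hx
    intro y hy z hz a b ha hb hab
    have := convex_convexHull ℝ S hy hz ha hb hab
    simpa [← add_mul, hab] using this

theorem convexHull_cayley_inj {A B A' B' : Set E}
    (h : convexHull ℝ (cayley A B) = convexHull ℝ (cayley A' B')) :
    convexHull ℝ A = convexHull ℝ A' ∧ convexHull ℝ B = convexHull ℝ B' := by
  have left : ∀ (C D : Set E) (x : E),
      (x, (-1 : ℝ)) ∈ convexHull ℝ (cayley C D) ↔ x ∈ convexHull ℝ C := fun C D x => by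
    rw [mem_convexHull_slice (by norm_num)
      (by rintro _ (⟨a, -, rfl⟩ | ⟨b, -, rfl⟩) <;> norm_num)]
    simp [left_mem_cayley]
  have right : ∀ (C D : Set E) (x : E),
      (x, (1 : ℝ)) ∈ convexHull ℝ (cayley C D) ↔ x ∈ convexHull ℝ D := fun C D x => by
    rw [mem_convexHull_slice (by norm_num)
      (by rintro _ (⟨a, -, rfl⟩ | ⟨b, -, rfl⟩) <;> norm_num)]
    simp [right_mem_cayley]
  constructor
  · ext x
    rw [← left A B, ← left A' B', h]
  · ext x
    rw [← right A B, ← right A' B', h]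

/-- If the Cayley cell selected by `Φ` meets both levels, then its slices are the minimizers of the
two height functions tilted by the restriction of `Φ` to `E`. -/
theorem slices_minimizers_cayley {A B : Set E} {f g : E → ℝ} {Φ : StrongDual ℝ (E × ℝ)} {a b : E}
    (ha : (a, (-1 : ℝ)) ∈ minimizers (cayley A B) (cayleyHeight f g) Φ)
    (hb : (b, (1 : ℝ)) ∈ minimizers (cayley A B) (cayleyHeight f g) Φ) :
    minimizers (cayley A B) (cayleyHeight f g) Φ =
      cayley (minimizers A f (Φ.comp (ContinuousLinearMap.inl ℝ E ℝ)))
        (minimizers B g (Φ.comp (ContinuousLinearMap.inl ℝ E ℝ))) := by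
  have key : ∀ x r, Φ (x, r) = Φ (x, 0) + r * Φ (0, 1) := apply_mk Φ
  have heq := le_antisymm (ha.2 _ hb.1) (hb.2 _ ha.1)
  rw [key a, key b, cayleyHeight_left, cayleyHeight_right] at heq
  rw [cayley_ext (minimizers_subset (cayley A B) (cayleyHeight f g) Φ)]
  congr 1
  · ext x
    constructor
    · rintro ⟨hx, hmin⟩
      refine ⟨left_mem_cayley.1 hx, fun y hy => ?_⟩
      have := hmin _ (left_mem_cayley.2 hy)
      rw [key x, key y, cayleyHeight_left, cayleyHeight_left] at this
      simp
      linarith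
    · rintro ⟨hx, hmin⟩
      refine ⟨left_mem_cayley.2 hx, fun p hp => (le_trans ?_ (ha.2 p hp))⟩
      have := hmin a (left_mem_cayley.1 ha.1)
      simp at this
      rw [key x, key a, cayleyHeight_left, cayleyHeight_left]
      linarith
  · ext x
    constructor
    · rintro ⟨hx, hmin⟩
      refine ⟨right_mem_cayley.1 hx, fun y hy => ?_⟩
      have := hmin _ (right_mem_cayley.2 hy)
      rw [key x, key y, cayleyHeight_right, cayleyHeight_right] at this
      simp
      linarith
    · rintro ⟨hx, hmin⟩
      refine ⟨right_mem_cayley.2 hx, fun p hp => (le_trans ?_ (hb.2 p hp))⟩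
      have := hmin b (right_mem_cayley.1 hb.1)
      simp at this
      rw [key x, key b, cayleyHeight_right, cayleyHeight_right]
      linarith

/-- Over a common functional `φ`, the minimizers of both height functions span a Cayley cell. -/
theorem convexHull_cayley_mem {A B : Set E} (hA : A.Finite) (hB : B.Finite) (f g : E → ℝ)
    (φ : StrongDual ℝ E) (hAne : A.Nonempty) (hBne : B.Nonempty) :
    convexHull ℝ (cayley (minimizers A f φ) (minimizers B g φ)) ∈
      regularSubdivision (cayley A B) (cayleyHeight f g) := by
  obtain ⟨a, ha⟩ := minimizers_nonempty hA hAne f φ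
  obtain ⟨b, hb⟩ := minimizers_nonempty hB hBne g φ
  -- The vertical slope `t` levels the two minimal values.
  set t : ℝ := ((g b - φ b) - (f a - φ a)) / 2 with ht
  let Φ : StrongDual ℝ (E × ℝ) :=
    φ.comp (ContinuousLinearMap.fst ℝ E ℝ) + t • ContinuousLinearMap.snd ℝ E ℝ
  have hΦ : ∀ x r, Φ (x, r) = φ x + t * r := fun x r => by simp [Φ]
  have hlow : ∀ p ∈ cayley A B, f a - φ a + t ≤ cayleyHeight f g p - Φ p := by
    rintro _ (⟨c, hc, rfl⟩ | ⟨c, hc, rfl⟩)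
    · simp only
      rw [hΦ, cayleyHeight_left]
      linarith [ha.2 c hc]
    · simp only
      rw [hΦ, cayleyHeight_right]
      linarith [hb.2 c hc]
  have ha' : (a, (-1 : ℝ)) ∈ minimizers (cayley A B) (cayleyHeight f g) Φ := by
    refine ⟨left_mem_cayley.2 ha.1, fun p hp => le_trans ?_ (hlow p hp)⟩
    rw [hΦ, cayleyHeight_left]
    linarith
  have hb' : (b, (1 : ℝ)) ∈ minimizers (cayley A B) (cayleyHeight f g) Φ := by
    refine ⟨right_mem_cayley.2 hb.1, fun p hp => le_trans ?_ (hlow p hp)⟩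
    rw [hΦ, cayleyHeight_right]
    linarith
  refine (mem_regularSubdivision_iff (finite_cayley hA hB)).2 (Or.inr ⟨Φ, ?_⟩)
  rw [slices_minimizers_cayley ha' hb']
  have : Φ.comp (ContinuousLinearMap.inl ℝ E ℝ) = φ := by
    ext x
    simp [hΦ]
  rw [this]

theorem mixedCell_eq_add (A B : Set E) : mixedCell A B = convexHull ℝ A + convexHull ℝ B :=
  convexHull_add A B

@[simp] theorem mixedCell_empty_left (B : Set E) : mixedCell ∅ B = ∅ := by simp [mixedCell]

@[simp] theorem mixedCell_empty_right (A : Set E) : mixedCell A ∅ = ∅ := by simp [mixedCell]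

@[simp] theorem cayley_empty {X : Type*} : cayley (∅ : Set X) ∅ = ∅ := by simp [cayley]

/-! ### Coherence of the regular subdivision of an infimal convolution -/

/-- The mixed cells induced by the regular subdivision of the Cayley embedding are the cells of the
regular subdivision by the infimal convolution. -/
theorem IsInfConvolution.regularSubdivision_eq_inducedMixed {A B : Set E} {f g h : E → ℝ}
    (H : IsInfConvolution A B f g h) (hA : A.Finite) (hB : B.Finite) :
    regularSubdivision (A + B) h =
      inducedMixed A B (regularSubdivision (cayley A B) (cayleyHeight f g)) := by
  have hempty : ∅ ∈ regularSubdivision (A + B) h :=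
    (mem_regularSubdivision_iff (hA.add hB)).2 (Or.inl rfl)
  ext C
  constructor
  · intro hC
    rcases C.eq_empty_or_nonempty with rfl | hne
    · exact ⟨∅, Set.empty_subset _, ∅, Set.empty_subset _,
        (mem_regularSubdivision_iff (finite_cayley hA hB)).2 (Or.inl (by simp)), by simp⟩
    rcases (mem_regularSubdivision_iff (hA.add hB)).1 hC with rfl | ⟨φ, rfl⟩
    · exact absurd hne Set.not_nonempty_empty
    rw [H.minimizers_add, convexHull_nonempty_iff] at hne
    refine ⟨_, minimizers_subset A f φ, _, minimizers_subset B g φ,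
      convexHull_cayley_mem hA hB f g φ (hne.of_add_left.mono (minimizers_subset A f φ))
        (hne.of_add_right.mono (minimizers_subset B g φ)), ?_⟩
    rw [H.minimizers_add, mixedCell]
  · rintro ⟨A', -, B', -, hT, rfl⟩
    rcases (mem_regularSubdivision_iff (finite_cayley hA hB)).1 hT with h0 | ⟨Φ, hΦ⟩
    · have hA' : A' = ∅ := by
        rw [convexHull_eq_empty, cayley, Set.union_empty_iff] at h0
        exact Set.image_eq_empty.1 h0.1
      rw [hA', mixedCell_empty_left]
      exact hempty
    · have hcells := cayley_ext (minimizers_subset (cayley A B) (cayleyHeight f g) Φ)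
      rw [hcells] at hΦ
      obtain ⟨hl, hr⟩ := convexHull_cayley_inj hΦ
      rw [mixedCell_eq_add, hl, hr, ← mixedCell_eq_add]
      by_cases hlne : ∃ a, (a, (-1 : ℝ)) ∈ minimizers (cayley A B) (cayleyHeight f g) Φ
      swap
      · rw [Set.eq_empty_of_forall_notMem (s := {a | (a, (-1 : ℝ)) ∈ minimizers _ _ Φ})
          (not_exists.1 hlne), mixedCell_empty_left]
        exact hempty
      by_cases hrne : ∃ b, (b, (1 : ℝ)) ∈ minimizers (cayley A B) (cayleyHeight f g) Φ
      swap
      · rw [Set.eq_empty_of_forall_notMem (s := {b | (b, (1 : ℝ)) ∈ minimizers _ _ Φ})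
          (not_exists.1 hrne), mixedCell_empty_right]
        exact hempty
      obtain ⟨a, ha⟩ := hlne
      obtain ⟨b, hb⟩ := hrne
      refine (mem_regularSubdivision_iff (hA.add hB)).2
        (Or.inr ⟨Φ.comp (ContinuousLinearMap.inl ℝ E ℝ), ?_⟩)
      rw [slices_minimizers_cayley ha hb, H.minimizers_add, mixedCell]
      simp only [left_mem_cayley, right_mem_cayley, Set.ofPred_mem_eq]

/-- The regular subdivision of `A + B` by an infimal convolution is a coherent mixed subdivision.
A nonempty cell, which consists of the minimizers for some functional `φ`, is labeled by the
minimizers of `f` and of `g` for the same `φ`. -/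
theorem IsInfConvolution.isCoherentMixedSubdivision [FiniteDimensional ℝ E] {A B : Set E}
    {f g h : E → ℝ} (H : IsInfConvolution A B f g h) (hA : A.Finite) (hB : B.Finite) :
    IsCoherentMixedSubdivision A B (regularSubdivision (A + B) h) := by
  classical
  have hφ : ∀ C : Set E, ∃ φ, C ∈ regularSubdivision (A + B) h → C.Nonempty →
      C = convexHull ℝ (minimizers (A + B) h φ) := by
    intro C
    by_cases hC : ∃ φ, C = convexHull ℝ (minimizers (A + B) h φ)
    · exact hC.imp fun φ hφ _ _ => hφ
    · refine ⟨0, fun hmem hne => ?_⟩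
      exact ((mem_regularSubdivision_iff (hA.add hB)).1 hmem).elim
        (fun h0 => absurd h0 hne.ne_empty) fun h1 => absurd h1 hC
  choose φ hφ using hφ
  -- The empty cell gets the empty label, which no functional would give it.
  let lA : Set E → Set E := fun C => if C.Nonempty then minimizers A f (φ C) else ∅
  let lB : Set E → Set E := fun C => if C.Nonempty then minimizers B g (φ C) else ∅
  have hlab : IsMixedLabeling A B (regularSubdivision (A + B) h) lA lB := by
    refine ⟨fun C _ => ?_, fun C _ => ?_, fun C hC => ?_, fun C hC D hD => ?_⟩
    · by_cases hne : C.Nonempty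
      · simpa [lA, hne] using minimizers_subset A f (φ C)
      · simp [lA, hne]
    · by_cases hne : C.Nonempty
      · simpa [lB, hne] using minimizers_subset B g (φ C)
      · simp [lB, hne]
    · by_cases hne : C.Nonempty
      · simp only [lA, lB, hne, if_true]
        rw [mixedCell, ← H.minimizers_add]
        exact hφ C hC hne
      · obtain rfl := Set.not_nonempty_iff_eq_empty.1 hne
        simp [lA]
    · by_cases hne : C.Nonempty
      · by_cases hne' : D.Nonempty
        · simp only [lA, lB, hne, hne', if_true]
          rw [mixedCell, ← H.minimizers_add_inter, ← convexHull_minimizers_inter,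
            ← hφ C hC hne, ← hφ D hD hne']
        · obtain rfl := Set.not_nonempty_iff_eq_empty.1 hne'
          simp [lA]
      · obtain rfl := Set.not_nonempty_iff_eq_empty.1 hne
        simp [lA]
  refine ⟨⟨isSubdivision_regularSubdivision (hA.add hB) h, lA, lB, hlab⟩, cayleyHeight f g,
    H.regularSubdivision_eq_inducedMixed hA hB, lA, lB, hlab, fun C hC => ?_⟩
  by_cases hne : C.Nonempty
  · have hne' := hne
    rw [hφ C hC hne, convexHull_nonempty_iff] at hne'
    have hAB := hne'.mono (minimizers_subset _ _ _)
    simp only [lA, lB, hne, if_true]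
    exact convexHull_cayley_mem hA hB f g (φ C) hAB.of_add_left hAB.of_add_right
  · simp only [lA, lB, hne, if_false, cayley_empty, convexHull_empty]
    exact (mem_regularSubdivision_iff (finite_cayley hA hB)).2 (Or.inl rfl)

/-! ### Tropical polynomials -/

/-- The inclusion of the exponent lattice `ℤ^d` into `ℝ^d`. -/
def latticePoint {d : ℕ} (m : Fin d → ℤ) : Fin d → ℝ := fun i => (m i : ℝ)

theorem latticePoint_add {d : ℕ} (m n : Fin d → ℤ) :
    latticePoint (m + n) = latticePoint m + latticePoint n := by
  ext i
  simp [latticePoint]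

theorem mem_supp {d : ℕ} {F : TropPoly d} {x : Fin d → ℝ} :
    x ∈ supp F ↔ ∃ m, F.coeff m ≠ 0 ∧ latticePoint m = x :=
  exists_congr fun _ => and_congr_right fun _ => eq_comm

theorem finite_supp {d : ℕ} (F : TropPoly d) : (supp F).Finite := by
  refine (F.coeff.support.finite_toSet.image latticePoint).subset fun x hx => ?_
  obtain ⟨m, hm, rfl⟩ := mem_supp.1 hx
  exact ⟨m, by simpa using hm, rfl⟩

theorem coe_height {d : ℕ} {F : TropPoly d} {m : Fin d → ℤ} (hm : F.coeff m ≠ 0) :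
    (height F (latticePoint m) : WithTop ℝ) = Tropical.untrop (F.coeff m) := by
  have hne : Tropical.untrop (F.coeff m) ≠ ⊤ := fun h => hm (Tropical.untrop_injective h)
  simp only [height, latticePoint, Int.floor_intCast]
  obtain ⟨r, hr⟩ := WithTop.ne_top_iff_exists.1 hne
  rw [← hr, WithTop.untopD_coe]

theorem untrop_coeff_mul {d : ℕ} (F G : TropPoly d) (m : Fin d → ℤ) :
    Tropical.untrop ((F * G).coeff m) =
      ((F.coeff.support ×ˢ G.coeff.support).filter fun p => p.1 + p.2 = m).inf
        fun p => Tropical.untrop (F.coeff p.1) + Tropical.untrop (G.coeff p.2) := by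
  classical
  have : (F * G).coeff m =
      ∑ p ∈ (F.coeff.support ×ˢ G.coeff.support).filter fun p => p.1 + p.2 = m,
        F.coeff p.1 * G.coeff p.2 := by
    rw [AddMonoidAlgebra.coeff_mul, Finset.sum_filter, Finset.sum_product]
    rfl
  rw [this, Finset.untrop_sum']
  rfl

theorem untrop_coeff_mul_le {d : ℕ} (F G : TropPoly d) {m n : Fin d → ℤ}
    (hm : F.coeff m ≠ 0) (hn : G.coeff n ≠ 0) :
    Tropical.untrop ((F * G).coeff (m + n)) ≤
      Tropical.untrop (F.coeff m) + Tropical.untrop (G.coeff n) := by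
  rw [untrop_coeff_mul]
  exact Finset.inf_le (b := (m, n)) (by simp [hm, hn])

theorem exists_untrop_coeff_mul {d : ℕ} {F G : TropPoly d} {k : Fin d → ℤ}
    (hk : (F * G).coeff k ≠ 0) :
    ∃ m n, F.coeff m ≠ 0 ∧ G.coeff n ≠ 0 ∧ m + n = k ∧
      Tropical.untrop ((F * G).coeff k) =
        Tropical.untrop (F.coeff m) + Tropical.untrop (G.coeff n) := by
  have e := untrop_coeff_mul F G k
  rcases ((F.coeff.support ×ˢ G.coeff.support).filter fun p => p.1 + p.2 = k).eq_empty_or_nonempty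
    with h0 | hne
  · rw [h0, Finset.inf_empty] at e
    exact absurd (Tropical.untrop_injective e) hk
  · obtain ⟨⟨m, n⟩, hmem, hmn⟩ := Finset.exists_mem_eq_inf _ hne
      fun p => Tropical.untrop (F.coeff p.1) + Tropical.untrop (G.coeff p.2)
    simp only [Finset.mem_filter, Finset.mem_product, Finsupp.mem_support_iff] at hmem
    exact ⟨m, n, hmem.1.1, hmem.1.2, hmem.2, e.trans hmn⟩

theorem coeff_mul_ne_zero {d : ℕ} {F G : TropPoly d} {m n : Fin d → ℤ}
    (hm : F.coeff m ≠ 0) (hn : G.coeff n ≠ 0) : (F * G).coeff (m + n) ≠ 0 := by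
  intro h0
  have := untrop_coeff_mul_le F G hm hn
  rw [h0, Tropical.untrop_zero, ← coe_height hm, ← coe_height hn, ← WithTop.coe_add] at this
  exact WithTop.coe_ne_top (top_le_iff.1 this)

/-- The sums of the tropical product are minima, so there is no cancellation. -/
theorem supp_mul {d : ℕ} (F G : TropPoly d) : supp (F * G) = supp F + supp G := by
  ext x
  constructor
  · intro hx
    obtain ⟨k, hk, rfl⟩ := mem_supp.1 hx
    obtain ⟨m, n, hm, hn, rfl, -⟩ := exists_untrop_coeff_mul hk
    rw [latticePoint_add]
    exact Set.add_mem_add (mem_supp.2 ⟨m, hm, rfl⟩) (mem_supp.2 ⟨n, hn, rfl⟩)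
  · rintro ⟨a, ha, b, hb, rfl⟩
    obtain ⟨m, hm, rfl⟩ := mem_supp.1 ha
    obtain ⟨n, hn, rfl⟩ := mem_supp.1 hb
    exact mem_supp.2 ⟨m + n, coeff_mul_ne_zero hm hn, latticePoint_add m n⟩

theorem isInfConvolution_height {d : ℕ} (F G : TropPoly d) :
    IsInfConvolution (supp F) (supp G) (height F) (height G) (height (F * G)) where
  le := by
    intro a ha b hb
    obtain ⟨m, hm, rfl⟩ := mem_supp.1 ha
    obtain ⟨n, hn, rfl⟩ := mem_supp.1 hb
    have := untrop_coeff_mul_le F G hm hn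
    rw [← coe_height hm, ← coe_height hn, ← coe_height (coeff_mul_ne_zero hm hn),
      latticePoint_add] at this
    exact_mod_cast this
  exists_eq := by
    intro x hx
    rw [← supp_mul] at hx
    obtain ⟨k, hk, rfl⟩ := mem_supp.1 hx
    obtain ⟨m, n, hm, hn, rfl, e⟩ := exists_untrop_coeff_mul hk
    refine ⟨_, mem_supp.2 ⟨m, hm, rfl⟩, _, mem_supp.2 ⟨n, hn, rfl⟩, (latticePoint_add m n).symm, ?_⟩
    rw [← coe_height hm, ← coe_height hn, ← coe_height hk] at e
    exact_mod_cast e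

end TropMixed

theorem mainTheorem4 (d : ℕ) (F G : TropMixed.TropPoly d) :
    TropMixed.IsCoherentMixedSubdivision (TropMixed.supp F) (TropMixed.supp G)
      (TropMixed.tropSubdivision (F * G)) := by
  rw [TropMixed.tropSubdivision, TropMixed.supp_mul]
  exact (TropMixed.isInfConvolution_height F G).isCoherentMixedSubdivision
    (TropMixed.finite_supp F) (TropMixed.finite_supp G)
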